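/- Let $d\ge 1$ be an integer, let $\mathbb B_d$ be the open unit ball of $\mathbb C^d$ (Euclidean norm) and $\partial\mathbb B_d$ the unit sphere. For a holomorphic function $f$ on $\mathbb B_d$ put $$|||f||| = \sup_{\zeta\in\partial\mathbb B_d}\ \sup_{0<r<1}\int_0^{2\pi}\log\bigl(1+|f(re^{i\theta}\zeta)|\bigr)\,\frac{d\theta}{2\pi}\in[0,\infty],\qquad \rho(f,g)=|||f-g|||,\qquad f_r(z)=f(rz)\quad(0<r<1).$$ Let $N_u$ be the set of holomorphic $f$ on $\mathbb B_d$ with $|||f|||<\infty$, and let $$N_u^+=\{f\in N_u:\ \lim_{r\uparrow1}\rho(f_r,f)=0\}.$$ Then $N_u^+$ is a complex algebra under the pointwise operations, $\rho$ is a metric on $N_u^+$, and $(N_u^+,\rho)$ is an F-space, i.e. the metric $\rho$ is complete and translation invariant, and addition and scalar multiplication are continuous. Moreover, multiplication $N_u^+\times N_u^+\to N_u^+$ is (jointly) continuous, and the polynomials in $z_1,\dots,z_d$ belong to $N_u^+$ and form a dense subset of $(N_u^+,\rho)$. -/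

import Mathlib

open Filter Topology
open scoped ENNReal

/-- The open unit ball of `ℂ^d` with its Euclidean norm. -/
abbrev UnitBall (d : ℕ) : Set (EuclideanSpace ℂ (Fin d)) := Metric.ball 0 1

/-- Complex-valued functions on the unit ball. This is a `def`, so that the topology of pointwise
convergence is not inherited: the only topology in play is the one given by the metric `rho`. -/
def BallFun (d : ℕ) : Type := UnitBall d → ℂ

namespace BallFun

variable {d : ℕ}

/-- The pointwise ring operations. -/
noncomputable instance : CommRing (BallFun d) := inferInstanceAs (CommRing (UnitBall d → ℂ))

/-- The pointwise scalar multiplication. -/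
noncomputable instance : Algebra ℂ (BallFun d) := inferInstanceAs (Algebra ℂ (UnitBall d → ℂ))

/-- Extension by zero to all of `ℂ^d`; a device for writing `f w` without a proof of `w ∈ 𝔹_d`.
Below it is only evaluated at points of the ball. -/
noncomputable def ext (f : BallFun d) : EuclideanSpace ℂ (Fin d) → ℂ :=
  Function.extend Subtype.val f 0

/-- `f` is holomorphic on the (open) unit ball. -/
def IsHolomorphic (f : BallFun d) : Prop := DifferentiableOn ℂ f.ext (UnitBall d)

/-- `sup_{‖ζ‖ = 1} sup_{0 < r < 1} ∫ log (1 + |f (r e^{iθ} ζ)|) dθ / 2π`, a value in `[0, ∞]`. -/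
noncomputable def size (f : BallFun d) : ℝ≥0∞ :=
  ⨆ ζ ∈ Metric.sphere (0 : EuclideanSpace ℂ (Fin d)) 1, ⨆ r ∈ Set.Ioo (0 : ℝ) 1,
    ENNReal.ofReal (Real.circleAverage (fun w : ℂ => Real.log (1 + ‖f.ext (w • ζ)‖)) 0 r)

/-- `ρ(f, g)`, the size of `f - g`. -/
noncomputable def rho (f g : BallFun d) : ℝ≥0∞ := (f - g).size

/-- The dilation `f_r(z) = f (r z)` (used for `0 < r < 1`). -/
noncomputable def dilate (r : ℝ) (f : BallFun d) : BallFun d := fun z => f.ext ((r : ℂ) • z.1)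

/-- The function on the ball defined by a polynomial in `d` variables. -/
noncomputable def ofPoly (p : MvPolynomial (Fin d) ℂ) : BallFun d :=
  fun z => MvPolynomial.eval (fun i => z.1 i) p

end BallFun

/-- The class `N_u` of holomorphic functions on the ball of finite size. -/
def uniformNevanlinna (d : ℕ) : Set (BallFun d) := {f | f.IsHolomorphic ∧ f.size < ∞}

/-- The uniform Smirnov class `N_u^+`: those `f ∈ N_u` with `ρ(f_r, f) → 0` as `r ↑ 1`. -/
def uniformSmirnov (d : ℕ) : Set (BallFun d) :=
  {f | f ∈ uniformNevanlinna d ∧ Tendsto (fun r : ℝ => (f.dilate r).rho f) (𝓝[<] 1) (𝓝 0)}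

/-- A complex vector space with a given metric is an F-space if the metric is complete and
translation invariant, and the vector space operations are continuous. -/
structure IsFSpace (V : Type*) [AddCommGroup V] [Module ℂ V] [MetricSpace V] : Prop where
  continuous_add : Continuous fun p : V × V => p.1 + p.2
  continuous_smul : Continuous fun p : ℂ × V => p.1 • p.2
  dist_add_right : ∀ f g h : V, dist (f + h) (g + h) = dist f g
  complete : CompleteSpace V

/-! ### Holomorphic functions on normed spaces: limits and derivatives -/

section SeveralVariables

variable {E : Type*} [NormedAddCommGroup E] [NormedSpace ℂ E]

/-! Since `log (1 + |a + b|)` and `log (1 + |a * b|)` are both at most `log (1 + |a|) + log (1 +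
|b|)`, the size is subadditive for sums and for products. This gives the triangle inequality and
continuity of addition.

Multiplication by a fixed `f` in `N_u^+` is the delicate point (`tendsto_size_mul`). Write `f = (f -
f_r) + f_r`: the first term has small size, and `f_r` is bounded, so Bernoulli's inequality `1 + n x
≤ (1 + x) ^ n` controls its products. Joint continuity, closure under products and continuity of
scalar multiplication follow.

On slices through the origin `log (1 + |f|)` is subharmonic, and averaging over an annulus bounds it
at `z` by `4 |||f||| / (1 - ‖z‖) ^ 2` (`log_one_add_norm_ext_le`). Hence `ρ` separates points and a
`ρ`-Cauchy sequence converges locally uniformly to a holomorphic function. The bounds on each circle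
pass to the limit, and since dilation does not increase the size, the limit stays in `N_u^+`.

For density, `f` is close to some `f_r`, which is a uniform limit of Taylor polynomials; uniform
distance dominates `ρ` because `log (1 + x) ≤ x`. -/

theorem norm_fderiv_le_of_norm_le_on_ball {f : E → ℂ} {c : E} {R C : ℝ} (hR : 0 < R)
    (hf : DifferentiableOn ℂ f (Metric.ball c R)) (hC : ∀ z ∈ Metric.ball c R, ‖f z‖ ≤ C) :
    ‖fderiv ℂ f c‖ ≤ 2 * C / R := by
  refine Complex.norm_fderiv_le_div_of_mapsTo_ball hf (fun z hz => ?_) hR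
  rw [Metric.mem_closedBall, dist_eq_norm]
  have h1 := hC z hz
  have h2 := hC c (Metric.mem_ball_self hR)
  linarith [norm_sub_le (f z) (f c)]

/-- A locally uniform limit of holomorphic functions on an open set of a normed space is
holomorphic. -/
theorem differentiableOn_of_tendstoUniformlyOn_nhds {F : ℕ → E → ℂ} {f : E → ℂ} {U : Set E}
    (hU : IsOpen U) (hF : ∀ n, DifferentiableOn ℂ (F n) U)
    (h : ∀ x ∈ U, ∃ t ∈ 𝓝 x, TendstoUniformlyOn F f atTop t) : DifferentiableOn ℂ f U := by
  intro x hx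
  obtain ⟨t, ht, hlim⟩ := h x hx
  obtain ⟨R, hR, hball⟩ := Metric.mem_nhds_iff.1 (inter_mem ht (hU.mem_nhds hx))
  have hsub : ∀ y ∈ Metric.ball x (R / 2), Metric.ball y (R / 2) ⊆ Metric.ball x R := by
    intro y hy
    refine Metric.ball_subset_ball' ?_
    rw [Metric.mem_ball] at hy
    linarith
  have hd : ∀ n, ∀ y ∈ Metric.ball x R, DifferentiableAt ℂ (F n) y := fun n y hy =>
    (hF n y (hball hy).2).differentiableAt (hU.mem_nhds (hball hy).2)
  have hcauchy : UniformCauchySeqOn (fun n => fderiv ℂ (F n)) atTop (Metric.ball x (R / 2)) := by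
    have h0 := (hlim.mono (fun y hy => (hball hy).1)).uniformCauchySeqOn
    rw [Metric.uniformCauchySeqOn_iff] at h0 ⊢
    intro ε hε
    -- The Cauchy estimate on balls of radius `R / 2` turns this tolerance into `ε / 2`.
    obtain ⟨N, hN⟩ := h0 (ε * R / 8) (by positivity)
    refine ⟨N, fun m hm n hn y hy => ?_⟩
    have hyx : y ∈ Metric.ball x R := Metric.ball_subset_ball (by linarith) hy
    have hb := norm_fderiv_le_of_norm_le_on_ball (f := F m - F n) (c := y) (R := R / 2)
      (C := ε * R / 8) (by positivity)
      (fun z hz => ((hd m z (hsub y hy hz)).sub (hd n z (hsub y hy hz))).differentiableWithinAt)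
      (fun z hz => by
        have := hN m hm n hn z (hsub y hy hz)
        rw [dist_eq_norm] at this
        exact this.le)
    rw [fderiv_sub (hd m y hyx) (hd n y hyx)] at hb
    rw [dist_eq_norm]
    refine hb.trans_lt ?_
    have : 2 * (ε * R / 8) / (R / 2) = ε / 2 := by field_simp; norm_num
    rw [this]
    linarith
  have hex : ∀ y, ∃ L, y ∈ Metric.ball x (R / 2) →
      Tendsto (fun n => fderiv ℂ (F n) y) atTop (𝓝 L) := by
    intro y
    by_cases hy : y ∈ Metric.ball x (R / 2)
    · obtain ⟨L, hL⟩ := cauchySeq_tendsto_of_complete (hcauchy.cauchySeq hy)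
      exact ⟨L, fun _ => hL⟩
    · exact ⟨0, fun h => absurd h hy⟩
  choose g' hg' using hex
  have := hasFDerivAt_of_tendstoUniformlyOn (f := F) (g := f) (x := x) Metric.isOpen_ball
    (hcauchy.tendstoUniformlyOn_of_tendsto hg')
    (fun n y hy => (hd n y (Metric.ball_subset_ball (by linarith) hy)).hasFDerivAt)
    (fun y hy => hlim.tendsto_at (hball (Metric.ball_subset_ball (by linarith) hy)).1)
    (Metric.mem_ball_self (by positivity))
  exact this.differentiableAt.differentiableWithinAt

theorem hasDerivAt_comp_add_smul {f : E → ℂ} {z v : E} {w : ℂ}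
    (hf : DifferentiableAt ℂ f (z + w • v)) :
    HasDerivAt (fun w : ℂ => f (z + w • v)) (fderiv ℂ f (z + w • v) v) w := by
  have h1 : HasDerivAt (fun w : ℂ => z + w • v) v w := by
    simpa using ((hasDerivAt_id w).smul_const v).const_add z
  exact hf.hasFDerivAt.comp_hasDerivAt w h1

/-- Directional derivatives of a holomorphic function are holomorphic. -/
theorem differentiableOn_fderiv_apply [FiniteDimensional ℂ E]
    {f : E → ℂ} {U : Set E} (hU : IsOpen U) (hf : DifferentiableOn ℂ f U) (v : E) :
    DifferentiableOn ℂ (fun z => fderiv ℂ f z v) U := by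
  borelize E
  have := FiniteDimensional.proper ℂ E
  intro x hx
  obtain ⟨R, hR, hball⟩ := Metric.nhds_basis_closedBall.mem_iff.1 (hU.mem_nhds hx)
  obtain ⟨C, hC⟩ := (isCompact_closedBall x R).exists_bound_of_continuousOn
    (hf.continuousOn.mono hball)
  have hd : ∀ y ∈ Metric.closedBall x R, DifferentiableAt ℂ f y := fun y hy =>
    (hf y (hball hy)).differentiableAt (hU.mem_nhds (hball hy))
  -- Circles of radius `r` in direction `v` about points of the `R / 4`-ball stay in the `R /
  -- 2`-ball, where Cauchy's estimate bounds the derivative. The `+ 1` covers `v = 0`.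
  obtain ⟨r, hr, hrv⟩ : ∃ r : ℝ, 0 < r ∧ r * ‖v‖ ≤ R / 4 := by
    refine ⟨R / 4 / (‖v‖ + 1), by positivity, ?_⟩
    rw [div_mul_eq_mul_div, div_le_iff₀ (by positivity)]
    nlinarith [norm_nonneg v]
  have hmem : ∀ z ∈ Metric.ball x (R / 4), ∀ w : ℂ, ‖w‖ ≤ r → z + w • v ∈ Metric.ball x (R / 2) := by
    intro z hz w hw
    rw [Metric.mem_ball, dist_eq_norm] at hz ⊢
    have : z + w • v - x = (z - x) + w • v := by abel
    rw [this]
    refine (norm_add_le _ _).trans_lt ?_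
    rw [norm_smul]
    have := mul_le_mul_of_nonneg_right hw (norm_nonneg v)
    linarith
  have hmem' : ∀ z ∈ Metric.ball x (R / 4), ∀ w : ℂ, ‖w‖ ≤ r → z + w • v ∈ Metric.closedBall x R :=
    fun z hz w hw => Metric.ball_subset_closedBall
      (Metric.ball_subset_ball (by linarith) (hmem z hz w hw))
  have hcm : ∀ θ, ‖circleMap 0 r θ‖ ≤ r := fun θ => by simp [abs_of_pos hr]
  let k : ℝ → ℂ := fun θ => deriv (circleMap 0 r) θ * ((circleMap 0 r θ - 0) ^ 2)⁻¹
  have hk : Continuous k := by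
    refine Continuous.mul ?_ (Continuous.inv₀ (by fun_prop) fun θ => ?_)
    · rw [show deriv (circleMap 0 r) = fun θ => circleMap 0 r θ * Complex.I from
        funext (deriv_circleMap 0 r)]
      fun_prop
    · simpa using hr.ne'
  -- Cauchy's formula on the slice `w ↦ f (z + w • v)` removes the derivative; the integral can then
  -- be differentiated in `z` under the integral sign.
  have hrep : ∀ z ∈ Metric.ball x (R / 4), fderiv ℂ f z v =
      (2 * Real.pi * Complex.I : ℂ)⁻¹ •
        ∫ θ in (0 : ℝ)..2 * Real.pi, k θ * f (z + circleMap 0 r θ • v) := by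
    intro z hz
    have hopen : IsOpen ((fun w : ℂ => z + w • v) ⁻¹' Metric.ball x (R / 2)) :=
      Metric.isOpen_ball.preimage (by fun_prop)
    have h1 := Complex.two_pi_I_inv_smul_circleIntegral_sub_sq_inv_smul_of_differentiable
      (f := fun w : ℂ => f (z + w • v)) (c := 0) (w₀ := 0) (R := r) hopen
      (fun w hw => hmem z hz w (by simpa using hw))
      (fun w hw => (hasDerivAt_comp_add_smul (hd _ (Metric.ball_subset_closedBall
        (Metric.ball_subset_ball (by linarith) hw)))).differentiableAt.differentiableWithinAt)
      (Metric.mem_ball_self hr)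
    rw [(hasDerivAt_comp_add_smul (hd _ (hmem' z hz 0 (by simpa using hr.le)))).deriv] at h1
    simp only [zero_smul, add_zero] at h1
    rw [← h1, circleIntegral]
    simp only [k, smul_eq_mul, mul_assoc]
  have hbound : ∀ y ∈ Metric.ball x (R / 2), ‖fderiv ℂ f y‖ ≤ 2 * C / (R / 2) := by
    intro y hy
    have hs : Metric.ball y (R / 2) ⊆ Metric.closedBall x R := by
      refine (Metric.ball_subset_ball' ?_).trans Metric.ball_subset_closedBall
      rw [Metric.mem_ball] at hy
      linarith
    exact norm_fderiv_le_of_norm_le_on_ball (by positivity)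
      (fun z hz => (hd z (hs hz)).differentiableWithinAt) (fun z hz => hC z (hs hz))
  have hcont : ∀ z ∈ Metric.ball x (R / 4),
      Continuous fun θ : ℝ => k θ * f (z + circleMap 0 r θ • v) := by
    intro z hz
    refine hk.mul (continuous_iff_continuousAt.2 fun θ => ?_)
    exact ContinuousAt.comp (f := fun θ : ℝ => z + circleMap 0 r θ • v) (g := f)
      (hd _ (hmem' z hz _ (hcm θ))).continuousAt (by fun_prop)
  have hx4 : x ∈ Metric.ball x (R / 4) := Metric.mem_ball_self (by positivity)
  have key := intervalIntegral.hasFDerivAt_integral_of_dominated_of_fderiv_le (𝕜 := ℂ)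
    (μ := MeasureTheory.volume) (a := 0) (b := 2 * Real.pi) (x₀ := x)
    (s := Metric.ball x (R / 4))
    (F := fun z θ => k θ * f (z + circleMap 0 r θ • v))
    (F' := fun z θ => k θ • fderiv ℂ f (z + circleMap 0 r θ • v))
    (bound := fun θ => ‖k θ‖ * (2 * C / (R / 2)))
    (Metric.ball_mem_nhds x (by positivity))
    (by
      filter_upwards [Metric.ball_mem_nhds x (show 0 < R / 4 by positivity)] with z hz
      exact (hcont z hz).aestronglyMeasurable)
    ((hcont x hx4).intervalIntegrable _ _)
    (by
      refine (hk.measurable.smul ?_).aestronglyMeasurable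
      exact (measurable_fderiv ℂ f).comp (by fun_prop : Continuous fun θ : ℝ =>
        x + circleMap 0 r θ • v).measurable)
    (by
      refine Eventually.of_forall fun θ _ z hz => ?_
      rw [norm_smul]
      exact mul_le_mul_of_nonneg_left (hbound _ (hmem z hz _ (hcm θ))) (norm_nonneg _))
    ((by fun_prop : Continuous fun θ => ‖k θ‖ * (2 * C / (R / 2))).intervalIntegrable _ _)
    (by
      refine Eventually.of_forall fun θ _ z hz => ?_
      have h1 := (hd _ (hmem' z hz _ (hcm θ))).hasFDerivAt
      have h2 : HasFDerivAt (fun z : E => z + circleMap 0 r θ • v)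
        (ContinuousLinearMap.id ℂ E) z := (hasFDerivAt_id z).add_const _
      exact (h1.comp z h2).const_smul (k θ))
  refine DifferentiableAt.differentiableWithinAt ?_
  refine (key.differentiableAt.const_smul ((2 * Real.pi * Complex.I : ℂ)⁻¹)).congr_of_eventuallyEq ?_
  filter_upwards [Metric.ball_mem_nhds x (show 0 < R / 4 by positivity)] with z hz
  exact hrep z hz

end SeveralVariables

/-! ### Taylor polynomials along complex lines -/

section PolynomialApproximation

variable {d : ℕ}

/-- The Taylor coefficients of a holomorphic function along lines through the origin are
polynomials in the direction. -/
theorem exists_mvPolynomial_eq_iteratedDeriv {U : Set (EuclideanSpace ℂ (Fin d))} (hU : IsOpen U)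
    (h0 : (0 : EuclideanSpace ℂ (Fin d)) ∈ U) (k : ℕ) :
    ∀ f : EuclideanSpace ℂ (Fin d) → ℂ, DifferentiableOn ℂ f U →
      ∃ p : MvPolynomial (Fin d) ℂ, ∀ z : EuclideanSpace ℂ (Fin d),
        iteratedDeriv k (fun t : ℂ => f (t • z)) 0 = MvPolynomial.eval (fun i => z i) p := by
  have hev : ∀ z : EuclideanSpace ℂ (Fin d), ∀ᶠ t : ℂ in 𝓝 0, t • z ∈ U := fun z =>
    ContinuousAt.eventually_mem (by fun_prop : Continuous fun t : ℂ => t • z).continuousAt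
      (hU.mem_nhds (by simpa using h0))
  induction k with
  | zero => exact fun f _ => ⟨MvPolynomial.C (f 0), fun z => by simp⟩
  | succ k ih =>
    intro f hf
    -- By the chain rule, the derivative of `f (t • z)` in `t` is the sum of `z i` times the `i`-th
    -- partial derivative at `t • z`, so the induction hypothesis is needed for the partial
    -- derivatives.
    choose p hp using fun i : Fin d => ih _ (differentiableOn_fderiv_apply hU hf
      (EuclideanSpace.single i 1))
    refine ⟨∑ i, MvPolynomial.X i * p i, fun z => ?_⟩
    have hder : deriv (fun t : ℂ => f (t • z)) =ᶠ[𝓝 0]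
        fun t => ∑ i, z i * fderiv ℂ f (t • z) (EuclideanSpace.single i 1) := by
      filter_upwards [hev z] with t ht
      have h1 := hasDerivAt_comp_add_smul (z := 0) (v := z) (w := t) (f := f)
        (by simpa using (hf _ ht).differentiableAt (hU.mem_nhds ht))
      simp only [zero_add] at h1
      rw [h1.deriv]
      have hz : z = ∑ i, z i • EuclideanSpace.single i (1 : ℂ) := by
        ext j
        simp [Pi.single_apply]
      conv_lhs => rw [hz]
      rw [map_sum]
      refine Finset.sum_congr rfl fun i _ => ?_
      rw [map_smul, smul_eq_mul, ← hz]
    have hsmooth : ∀ i, ContDiffAt ℂ k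
        (fun t : ℂ => fderiv ℂ f (t • z) (EuclideanSpace.single i 1)) 0 := by
      intro i
      refine AnalyticAt.contDiffAt (Complex.analyticAt_iff_eventually_differentiableAt.2 ?_)
      filter_upwards [hev z] with t ht
      have := differentiableOn_fderiv_apply hU hf (EuclideanSpace.single i 1) _ ht
      exact (this.differentiableAt (hU.mem_nhds ht)).comp (f := fun t : ℂ => t • z) t (by fun_prop)
    rw [iteratedDeriv_succ', hder.iteratedDeriv_eq,
      iteratedDeriv_fun_sum fun i _ => contDiffAt_const.mul (hsmooth i)]
    rw [map_sum]
    refine Finset.sum_congr rfl fun i _ => ?_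
    rw [iteratedDeriv_const_mul_field, hp]
    simp

/-- The dilations of a holomorphic function on the ball are uniform limits of polynomials. -/
theorem exists_mvPolynomial_norm_sub_le {f : EuclideanSpace ℂ (Fin d) → ℂ}
    (hf : DifferentiableOn ℂ f (Metric.ball 0 1)) {r : ℝ} (hr : r ∈ Set.Ioo (0 : ℝ) 1)
    {ε : ℝ} (hε : 0 < ε) :
    ∃ p : MvPolynomial (Fin d) ℂ, ∀ z ∈ Metric.ball (0 : EuclideanSpace ℂ (Fin d)) 1,
      ‖f ((r : ℂ) • z) - MvPolynomial.eval (fun i => z i) p‖ ≤ ε := by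
  obtain ⟨hr0, hr1⟩ := hr
  -- Cauchy's estimate on `|t| = s` bounds the `k`-th Taylor term of `t ↦ f (t • z)` at `t = r` by
  -- `M * (r / s) ^ k`, uniformly in `z`.
  obtain ⟨s, hrs, hs1⟩ := exists_between hr1
  have hs0 : 0 < s := hr0.trans hrs
  obtain ⟨M, hM⟩ := (isCompact_closedBall (0 : EuclideanSpace ℂ (Fin d)) s).exists_bound_of_continuousOn
    (hf.continuousOn.mono (Metric.closedBall_subset_ball hs1))
  have hq0 : 0 ≤ r / s := by positivity
  have hq1 : r / s < 1 := (div_lt_one hs0).2 hrs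
  obtain ⟨n, hn⟩ : ∃ n : ℕ, M * (r / s) ^ n / (1 - r / s) < ε := by
    have : Tendsto (fun n : ℕ => M * (r / s) ^ n / (1 - r / s)) atTop (𝓝 (M * 0 / (1 - r / s))) :=
      ((tendsto_pow_atTop_nhds_zero_of_lt_one hq0 hq1).const_mul M).div_const _
    simp only [mul_zero, zero_div] at this
    exact (this.eventually_lt_const hε).exists
  choose p hp using fun k : ℕ => exists_mvPolynomial_eq_iteratedDeriv Metric.isOpen_ball
    (Metric.mem_ball_self one_pos) k f hf
  refine ⟨∑ k ∈ Finset.range n, MvPolynomial.C (((k.factorial : ℂ))⁻¹ * (r : ℂ) ^ k) * p k,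
    fun z hz => ?_⟩
  have hz1 : ‖z‖ < 1 := by simpa using hz
  have hφ : DifferentiableOn ℂ (fun t : ℂ => f (t • z)) (Metric.ball 0 1) := by
    intro t ht
    have htz : t • z ∈ Metric.ball (0 : EuclideanSpace ℂ (Fin d)) 1 := by
      rw [mem_ball_zero_iff] at ht ⊢
      rw [norm_smul]
      nlinarith [norm_nonneg t, norm_nonneg z]
    exact (((hf _ htz).differentiableAt (Metric.isOpen_ball.mem_nhds htz)).comp (f := fun t : ℂ => t • z) t
      (by fun_prop)).differentiableWithinAt
  have hsum := Complex.hasSum_taylorSeries_on_ball hφ (z := (r : ℂ))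
    (by simpa [abs_of_pos hr0] using hr1)
  have hbound : ∀ k : ℕ, ‖((k.factorial : ℂ))⁻¹ • ((r : ℂ) - 0) ^ k •
      iteratedDeriv k (fun t : ℂ => f (t • z)) 0‖ ≤ M * (r / s) ^ k := by
    intro k
    have h1 := Complex.norm_iteratedDeriv_le_of_forall_mem_sphere_norm_le (C := M) k hs0
      (hφ.diffContOnCl_ball (Metric.closedBall_subset_ball hs1)) (fun t ht => by
        refine hM _ ?_
        rw [mem_sphere_zero_iff_norm] at ht
        rw [mem_closedBall_zero_iff, norm_smul, ht]
        nlinarith)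
    have hk : (0 : ℝ) < k.factorial := by exact_mod_cast k.factorial_pos
    rw [norm_smul, norm_smul, norm_inv, Complex.norm_natCast, sub_zero, norm_pow,
      Complex.norm_real, Real.norm_of_nonneg hr0.le]
    calc ((k.factorial : ℝ))⁻¹ * (r ^ k * ‖iteratedDeriv k (fun t : ℂ => f (t • z)) 0‖)
        ≤ ((k.factorial : ℝ))⁻¹ * (r ^ k * (k.factorial * M / s ^ k)) := by gcongr
      _ = M * (r / s) ^ k := by
        rw [div_pow]
        field_simp
  have := norm_sub_le_of_geometric_bound_of_hasSum hq1 hbound hsum n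
  rw [norm_sub_rev]
  refine le_trans (le_of_eq ?_) (this.trans hn.le)
  congr 2
  rw [map_sum]
  refine Finset.sum_congr rfl fun k _ => ?_
  rw [hp]
  simp [mul_assoc]

end PolynomialApproximation

/-! ### Subharmonicity of log (1 + |f|) and the interior estimate -/

section Submean

open MeasureTheory

/-- In Jensen's formula the zeros of `g` contribute only nonnegative terms. -/
theorem log_norm_le_circleAverage_log_norm {g : ℂ → ℂ} {c : ℂ} {R : ℝ} (hR : 0 < R)
    (hg : AnalyticOnNhd ℂ g (Metric.closedBall c R)) (hgc : g c ≠ 0) :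
    Real.log ‖g c‖ ≤ Real.circleAverage (Real.log ‖g ·‖) c R := by
  rw [← abs_of_pos hR] at hg
  rw [hg.circleAverage_log_norm hR.ne' hgc, le_add_iff_nonneg_left]
  refine finsum_nonneg fun u => ?_
  by_cases hu : u ∈ Metric.closedBall c |R|
  · refine mul_nonneg (mod_cast MeromorphicOn.AnalyticOnNhd.divisor_nonneg hg ..) ?_
    rcases eq_or_ne u c with rfl | hne
    · simp
    · have hpos : 0 < ‖c - u‖ := norm_pos_iff.2 (sub_ne_zero.2 hne.symm)
      refine Real.log_nonneg ?_
      rw [← div_eq_mul_inv, one_le_div hpos]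
      rwa [abs_of_pos hR, Metric.mem_closedBall, dist_eq_norm, norm_sub_rev] at hu
  · simp [hu]

/-- For a unimodular `u` with `u * f c = |f c|`, Jensen's inequality applies to `1 + u * f`: its
modulus equals `1 + |f c|` at `c` and is at most `1 + |f|` everywhere. -/
theorem log_one_add_norm_le_circleAverage {f : ℂ → ℂ} {c : ℂ} {R : ℝ} (hR : 0 < R)
    (hf : AnalyticOnNhd ℂ f (Metric.closedBall c R)) :
    Real.log (1 + ‖f c‖) ≤ Real.circleAverage (fun w => Real.log (1 + ‖f w‖)) c R := by
  obtain ⟨u, hu, huf⟩ : ∃ u : ℂ, ‖u‖ = 1 ∧ u * f c = ‖f c‖ := by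
    rcases eq_or_ne (f c) 0 with h | h
    · exact ⟨1, by simp, by simp [h]⟩
    · have : (‖f c‖ : ℂ) ≠ 0 := by simpa using h
      exact ⟨‖f c‖ / f c, by simp [h], by field_simp⟩
  have hgan : AnalyticOnNhd ℂ (fun w => 1 + u * f w) (Metric.closedBall c R) :=
    analyticOnNhd_const.add (analyticOnNhd_const.mul hf)
  have hgc : (1 : ℂ) + u * f c = ((1 + ‖f c‖ : ℝ) : ℂ) := by rw [huf]; push_cast; rfl
  have hpos : 0 < 1 + ‖f c‖ := by positivity
  have h1 := log_norm_le_circleAverage_log_norm hR hgan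
    (by rw [hgc]; exact_mod_cast hpos.ne')
  rw [hgc, Complex.norm_real, Real.norm_of_nonneg hpos.le] at h1
  refine h1.trans (Real.circleAverage_mono ?_ ?_ ?_)
  · refine MeromorphicOn.circleIntegrable_log_norm ?_
    rw [abs_of_pos hR]
    exact (hgan.mono Metric.sphere_subset_closedBall).meromorphicOn
  · refine ContinuousOn.circleIntegrable hR.le ?_
    refine ContinuousOn.log ?_ fun w _ => by positivity
    exact continuousOn_const.add (hf.continuousOn.mono Metric.sphere_subset_closedBall).norm
  · intro w _
    -- At a zero the convention `log 0 = 0` still gives the inequality.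
    rcases eq_or_ne (1 + u * f w) 0 with h | h
    · simp only [h, norm_zero, Real.log_zero]
      exact Real.log_nonneg (by linarith [norm_nonneg (f w)])
    · refine Real.log_le_log (norm_pos_iff.2 h) ((norm_add_le _ _).trans ?_)
      simp [hu]

theorem lintegral_eq_lintegral_circleMap {G : ℂ → ℝ≥0∞} (hG : Measurable G) (c : ℂ) :
    ∫⁻ z, G z = ∫⁻ ρ in Set.Ioi (0 : ℝ), ENNReal.ofReal ρ *
      ∫⁻ θ in Set.Ioo (-Real.pi) Real.pi, G (circleMap c ρ θ) := by
  have hm : Measurable fun p : ℝ × ℝ => G (circleMap c p.1 p.2) :=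
    hG.comp (by unfold circleMap; fun_prop : Continuous fun p : ℝ × ℝ =>
      circleMap c p.1 p.2).measurable
  rw [← lintegral_add_left_eq_self G c, ← Complex.lintegral_comp_polarCoord_symm, polarCoord_target,
    Measure.volume_eq_prod, ← Measure.prod_restrict, lintegral_prod]
  · refine lintegral_congr fun ρ => ?_
    rw [← lintegral_const_mul _ (show Measurable fun θ => G (circleMap c ρ θ) from
      hm.comp measurable_prodMk_left)]
    refine lintegral_congr fun θ => ?_
    simp [circleMap, Complex.exp_mul_I]
  · have : ∀ p : ℝ × ℝ, ENNReal.ofReal p.1 • G (c + Complex.polarCoord.symm p) =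
        ENNReal.ofReal p.1 * G (circleMap c p.1 p.2) := fun p => by
      simp [circleMap, Complex.exp_mul_I]
    simp_rw [this]
    exact ((ENNReal.measurable_ofReal.comp measurable_fst).mul hm).aemeasurable

theorem lintegral_ofReal_comp_circleMap {u : ℂ → ℝ} {c : ℂ} {R : ℝ}
    (hu : Continuous fun θ => u (circleMap c R θ)) (hnonneg : ∀ w, 0 ≤ u w) :
    ∫⁻ θ in Set.Ioo (-Real.pi) Real.pi, ENNReal.ofReal (u (circleMap c R θ)) =
      ENNReal.ofReal (2 * Real.pi * Real.circleAverage u c R) := by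
  have hpi := Real.pi_pos
  rw [Real.circleAverage_eq_integral_add (-Real.pi),
    intervalIntegral.integral_comp_add_right (fun θ => u (circleMap c R θ)), smul_eq_mul,
    mul_inv_cancel_left₀ (by positivity), intervalIntegral.integral_of_le (by linarith),
    ofReal_integral_eq_lintegral_ofReal]
  · rw [show 2 * Real.pi + -Real.pi = Real.pi by ring, zero_add]
    exact setLIntegral_congr Ioo_ae_eq_Ioc
  · exact (hu.integrableOn_Icc).mono_set Set.Ioc_subset_Icc_self
  · exact Eventually.of_forall fun θ => hnonneg _

/-- Interior estimate for `log (1 + |f|)` in terms of its averages over centered circles. -/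
theorem log_one_add_norm_le_of_circleAverage_le {f : ℂ → ℂ}
    (hf : DifferentiableOn ℂ f (Metric.ball 0 1)) {B : ℝ}
    (hB : ∀ r ∈ Set.Ioo (0 : ℝ) 1,
      Real.circleAverage (fun w => Real.log (1 + ‖f w‖)) 0 r ≤ B)
    {a : ℂ} (ha : ‖a‖ < 1) :
    Real.log (1 + ‖f a‖) ≤ 4 * B / (1 - ‖a‖) ^ 2 := by
  set h : ℂ → ℝ := fun w => Real.log (1 + ‖f w‖) with hdef
  have hpi := Real.pi_pos
  have hnonneg : ∀ w, 0 ≤ h w := fun w => Real.log_nonneg (by linarith [norm_nonneg (f w)])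
  have hcont : ContinuousOn h (Metric.ball 0 1) :=
    (continuousOn_const.add hf.continuousOn.norm).log fun w _ =>
      (add_pos_of_pos_of_nonneg one_pos (norm_nonneg _)).ne'
  set G : ℂ → ℝ≥0∞ := (Metric.ball (0 : ℂ) 1).indicator fun w => ENNReal.ofReal (h w) with hGdef
  have hGm : Measurable G := by
    classical
    rw [hGdef, ← Set.piecewise_eq_indicator]
    exact (ENNReal.continuous_ofReal.comp_continuousOn hcont).measurable_piecewise
      continuousOn_const Metric.isOpen_ball.measurableSet
  set δ := 1 - ‖a‖ with hδ
  have hδ0 : 0 < δ := by linarith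
  have hcircle : ∀ (c : ℂ) (ρ : ℝ), 0 < ρ → Metric.closedBall c ρ ⊆ Metric.ball 0 1 →
      ∫⁻ θ in Set.Ioo (-Real.pi) Real.pi, G (circleMap c ρ θ) =
        ENNReal.ofReal (2 * Real.pi * Real.circleAverage h c ρ) := by
    intro c ρ hρ hsub
    have hmem : ∀ θ, circleMap c ρ θ ∈ Metric.ball (0 : ℂ) 1 := fun θ =>
      hsub (circleMap_mem_closedBall c hρ.le θ)
    rw [← lintegral_ofReal_comp_circleMap _ hnonneg]
    · refine lintegral_congr fun θ => ?_
      rw [hGdef, Set.indicator_of_mem (hmem θ)]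
    · exact hcont.comp_continuous (continuous_circleMap c ρ) hmem
  have hB0 : 0 ≤ B := le_trans (Real.circleAverage_nonneg_of_nonneg fun w _ => hnonneg w)
    (hB (1 / 2) (by norm_num))
  -- In polar coordinates at `0` the weight `ρ` is bounded by `1`.
  have hupper : ∫⁻ z, G z ≤ ENNReal.ofReal (2 * Real.pi * B) := by
    rw [lintegral_eq_lintegral_circleMap hGm 0]
    calc ∫⁻ ρ in Set.Ioi (0 : ℝ), ENNReal.ofReal ρ *
          ∫⁻ θ in Set.Ioo (-Real.pi) Real.pi, G (circleMap 0 ρ θ)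
        ≤ ∫⁻ ρ in Set.Ioi (0 : ℝ), (Set.Ioo (0 : ℝ) 1).indicator
            (fun _ => ENNReal.ofReal (2 * Real.pi * B)) ρ := by
          refine setLIntegral_mono' measurableSet_Ioi fun ρ hρ => ?_
          rw [Set.mem_Ioi] at hρ
          by_cases hρ1 : ρ < 1
          · rw [hcircle 0 ρ hρ (Metric.closedBall_subset_ball hρ1),
              Set.indicator_of_mem (Set.mem_Ioo.2 ⟨hρ, hρ1⟩), ← ENNReal.ofReal_mul hρ.le]
            refine ENNReal.ofReal_le_ofReal ?_
            have h1 := hB ρ ⟨hρ, hρ1⟩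
            have h2 : 0 ≤ Real.circleAverage h 0 ρ :=
              Real.circleAverage_nonneg_of_nonneg fun w _ => hnonneg w
            calc ρ * (2 * Real.pi * Real.circleAverage h 0 ρ)
                ≤ 1 * (2 * Real.pi * Real.circleAverage h 0 ρ) := by gcongr
              _ ≤ 2 * Real.pi * B := by rw [one_mul]; gcongr
          · have : ∀ θ, G (circleMap 0 ρ θ) = 0 := fun θ => by
              rw [hGdef, Set.indicator_of_notMem]
              simpa [abs_of_pos hρ] using hρ1
            simp [this]
      _ ≤ ∫⁻ ρ, (Set.Ioo (0 : ℝ) 1).indicator (fun _ => ENNReal.ofReal (2 * Real.pi * B)) ρ :=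
          setLIntegral_le_lintegral _ _
      _ = ENNReal.ofReal (2 * Real.pi * B) := by
          rw [lintegral_indicator measurableSet_Ioo]
          simp
  -- On the annulus `δ / 2 < |w - a| < δ`, inside the disc, the sub-mean value property applies to
  -- each circle. The weight is at least `δ / 2` and the width is `δ / 2`, whence the factor `4` in
  -- the estimate.
  have hlower : ENNReal.ofReal (δ / 2 * (2 * Real.pi * h a) * (δ / 2)) ≤ ∫⁻ z, G z := by
    rw [lintegral_eq_lintegral_circleMap hGm a]
    calc ENNReal.ofReal (δ / 2 * (2 * Real.pi * h a) * (δ / 2))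
        = ∫⁻ ρ in Set.Ioo (δ / 2) δ, ENNReal.ofReal (δ / 2 * (2 * Real.pi * h a)) := by
          have := hnonneg a
          rw [setLIntegral_const, Real.volume_Ioo, ← ENNReal.ofReal_mul (by positivity)]
          congr 2
          ring
      _ ≤ ∫⁻ ρ in Set.Ioo (δ / 2) δ, ENNReal.ofReal ρ *
            ∫⁻ θ in Set.Ioo (-Real.pi) Real.pi, G (circleMap a ρ θ) := by
          refine setLIntegral_mono' measurableSet_Ioo fun ρ hρ => ?_
          have hρ0 : 0 < ρ := by linarith [hρ.1]
          have hsub : Metric.closedBall a ρ ⊆ Metric.ball 0 1 := by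
            refine Metric.closedBall_subset_ball' ?_
            rw [dist_zero_right]
            linarith [hρ.2]
          rw [hcircle a ρ hρ0 hsub, ← ENNReal.ofReal_mul hρ0.le]
          refine ENNReal.ofReal_le_ofReal ?_
          have h1 : h a ≤ Real.circleAverage h a ρ := log_one_add_norm_le_circleAverage hρ0
            ((hf.analyticOnNhd Metric.isOpen_ball).mono hsub)
          have := hnonneg a
          have := hρ.1
          gcongr
      _ ≤ _ := lintegral_mono_set fun ρ hρ => Set.mem_Ioi.2 (by linarith [hρ.1])
  have hfin := hlower.trans hupper
  rw [ENNReal.ofReal_le_ofReal_iff (by positivity)] at hfin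
  rw [le_div_iff₀ (by positivity)]
  have : Real.pi * (h a * δ ^ 2) ≤ Real.pi * (4 * B) := by nlinarith
  exact le_of_mul_le_mul_left this hpi

end Submean

/-! ### The size functional: algebraic inequalities and pointwise control -/

namespace BallFun

variable {d : ℕ}

theorem ext_of_mem (f : BallFun d) {z : EuclideanSpace ℂ (Fin d)} (hz : z ∈ UnitBall d) :
    f.ext z = f ⟨z, hz⟩ :=
  Subtype.val_injective.extend_apply (g := f) (e' := (0 : EuclideanSpace ℂ (Fin d) → ℂ)) (⟨z, hz⟩ : UnitBall d)

theorem ext_of_notMem (f : BallFun d) {z : EuclideanSpace ℂ (Fin d)} (hz : z ∉ UnitBall d) :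
    f.ext z = 0 :=
  Function.extend_apply' (g := f) (0 : EuclideanSpace ℂ (Fin d) → ℂ) z fun ⟨a, ha⟩ => hz (ha ▸ a.2)

theorem ext_coe (f : BallFun d) (z : UnitBall d) : f.ext z = f z :=
  f.ext_of_mem z.2

@[simp]
theorem ext_add (f g : BallFun d) (z : EuclideanSpace ℂ (Fin d)) :
    (f + g).ext z = f.ext z + g.ext z := by
  by_cases hz : z ∈ UnitBall d
  · simp only [ext_of_mem _ hz]
    rfl
  · simp only [ext_of_notMem _ hz, add_zero]

@[simp]
theorem ext_sub (f g : BallFun d) (z : EuclideanSpace ℂ (Fin d)) :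
    (f - g).ext z = f.ext z - g.ext z := by
  by_cases hz : z ∈ UnitBall d
  · simp only [ext_of_mem _ hz]
    rfl
  · simp only [ext_of_notMem _ hz, sub_zero]

@[simp]
theorem ext_mul (f g : BallFun d) (z : EuclideanSpace ℂ (Fin d)) :
    (f * g).ext z = f.ext z * g.ext z := by
  by_cases hz : z ∈ UnitBall d
  · simp only [ext_of_mem _ hz]
    rfl
  · simp only [ext_of_notMem _ hz, mul_zero]

theorem IsHolomorphic.of_eq {f : BallFun d} {F : EuclideanSpace ℂ (Fin d) → ℂ}
    (hF : DifferentiableOn ℂ F (UnitBall d)) (h : ∀ z : UnitBall d, f z = F z) :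
    f.IsHolomorphic :=
  hF.congr fun z hz => by rw [ext_of_mem _ hz, h]

theorem IsHolomorphic.add {f g : BallFun d} (hf : f.IsHolomorphic) (hg : g.IsHolomorphic) :
    (f + g).IsHolomorphic :=
  (DifferentiableOn.add hf hg).congr fun z _ => ext_add f g z

theorem IsHolomorphic.sub {f g : BallFun d} (hf : f.IsHolomorphic) (hg : g.IsHolomorphic) :
    (f - g).IsHolomorphic :=
  (DifferentiableOn.sub hf hg).congr fun z _ => ext_sub f g z

theorem IsHolomorphic.mul {f g : BallFun d} (hf : f.IsHolomorphic) (hg : g.IsHolomorphic) :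
    (f * g).IsHolomorphic :=
  (DifferentiableOn.mul hf hg).congr fun z _ => ext_mul f g z

theorem smul_mem_unitBall {z : EuclideanSpace ℂ (Fin d)} {w : ℂ} (hw : ‖w‖ ≤ 1)
    (hz : z ∈ UnitBall d) : w • z ∈ UnitBall d := by
  rw [mem_ball_zero_iff] at hz ⊢
  rw [norm_smul]
  exact (mul_le_of_le_one_left (norm_nonneg z) hw).trans_lt hz

theorem smul_mem_unitBall_of_mem_sphere {ζ : EuclideanSpace ℂ (Fin d)} {w : ℂ} (hw : ‖w‖ < 1)
    (hζ : ζ ∈ Metric.sphere (0 : EuclideanSpace ℂ (Fin d)) 1) : w • ζ ∈ UnitBall d := by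
  rw [mem_sphere_zero_iff_norm] at hζ
  rwa [mem_ball_zero_iff, norm_smul, hζ, mul_one]

theorem norm_ofReal_lt_one {r : ℝ} (hr : r ∈ Set.Ioo (0 : ℝ) 1) : ‖(r : ℂ)‖ < 1 := by
  rw [Complex.norm_real, Real.norm_of_nonneg hr.1.le]
  exact hr.2

theorem ext_dilate (f : BallFun d) (r : ℝ) {z : EuclideanSpace ℂ (Fin d)} (hz : z ∈ UnitBall d) :
    (f.dilate r).ext z = f.ext ((r : ℂ) • z) :=
  ext_of_mem _ hz

theorem IsHolomorphic.dilate {f : BallFun d} (hf : f.IsHolomorphic) {r : ℝ}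
    (hr : r ∈ Set.Ioo (0 : ℝ) 1) : (f.dilate r).IsHolomorphic := by
  refine .of_eq (F := fun z => f.ext ((r : ℂ) • z)) ?_ fun z => rfl
  exact DifferentiableOn.comp (g := f.ext) hf (by fun_prop)
    fun z hz => smul_mem_unitBall (norm_ofReal_lt_one hr).le hz

theorem dilate_add (f g : BallFun d) (r : ℝ) : (f + g).dilate r = f.dilate r + g.dilate r :=
  funext fun _ => ext_add f g _

theorem dilate_sub (f g : BallFun d) (r : ℝ) : (f - g).dilate r = f.dilate r - g.dilate r :=
  funext fun _ => ext_sub f g _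

theorem dilate_mul (f g : BallFun d) (r : ℝ) : (f * g).dilate r = f.dilate r * g.dilate r :=
  funext fun _ => ext_mul f g _

theorem isHolomorphic_algebraMap (c : ℂ) : (algebraMap ℂ (BallFun d) c).IsHolomorphic :=
  .of_eq (F := fun _ => c) (differentiableOn_const c) fun _ => rfl

theorem dilate_algebraMap (c : ℂ) {r : ℝ} (hr : r ∈ Set.Ioo (0 : ℝ) 1) :
    (algebraMap ℂ (BallFun d) c).dilate r = algebraMap ℂ (BallFun d) c :=
  funext fun z => ext_of_mem _ (smul_mem_unitBall (norm_ofReal_lt_one hr).le z.2)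

/-- The average of `log (1 + |f|)` over the circle of radius `r` in the slice through `ζ`. -/
noncomputable def mean (f : BallFun d) (ζ : EuclideanSpace ℂ (Fin d)) (r : ℝ) : ℝ :=
  Real.circleAverage (fun w : ℂ => Real.log (1 + ‖f.ext (w • ζ)‖)) 0 r

theorem mean_le_size (f : BallFun d) {ζ : EuclideanSpace ℂ (Fin d)}
    (hζ : ζ ∈ Metric.sphere (0 : EuclideanSpace ℂ (Fin d)) 1) {r : ℝ}
    (hr : r ∈ Set.Ioo (0 : ℝ) 1) : ENNReal.ofReal (f.mean ζ r) ≤ f.size :=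
  le_iSup₂_of_le (f := fun ζ _ => ⨆ r ∈ Set.Ioo (0 : ℝ) 1, ENNReal.ofReal (f.mean ζ r)) ζ hζ
    (le_iSup₂ (f := fun r _ => ENNReal.ofReal (f.mean ζ r)) r hr)

theorem size_le {f : BallFun d} {C : ℝ≥0∞}
    (h : ∀ ζ ∈ Metric.sphere (0 : EuclideanSpace ℂ (Fin d)) 1, ∀ r ∈ Set.Ioo (0 : ℝ) 1,
      ENNReal.ofReal (f.mean ζ r) ≤ C) : f.size ≤ C :=
  iSup₂_le fun ζ hζ => iSup₂_le fun r hr => h ζ hζ r hr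

theorem log_one_add_norm_nonneg (a : ℂ) : 0 ≤ Real.log (1 + ‖a‖) :=
  Real.log_nonneg (by linarith [norm_nonneg a])

theorem mean_nonneg (f : BallFun d) (ζ : EuclideanSpace ℂ (Fin d)) (r : ℝ) : 0 ≤ f.mean ζ r :=
  Real.circleAverage_nonneg_of_nonneg fun _ _ => log_one_add_norm_nonneg _

theorem IsHolomorphic.circleIntegrable {f : BallFun d} (hf : f.IsHolomorphic)
    {ζ : EuclideanSpace ℂ (Fin d)} (hζ : ζ ∈ Metric.sphere (0 : EuclideanSpace ℂ (Fin d)) 1)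
    {r : ℝ} (hr : r ∈ Set.Ioo (0 : ℝ) 1) :
    CircleIntegrable (fun w : ℂ => Real.log (1 + ‖f.ext (w • ζ)‖)) 0 r := by
  refine ContinuousOn.circleIntegrable hr.1.le ?_
  refine ContinuousOn.log ?_ fun w _ => (add_pos_of_pos_of_nonneg one_pos (norm_nonneg _)).ne'
  refine continuousOn_const.add (ContinuousOn.norm ?_)
  refine ContinuousOn.comp (g := f.ext) (DifferentiableOn.continuousOn hf) (by fun_prop) fun w hw => ?_
  refine smul_mem_unitBall_of_mem_sphere ?_ hζ
  rw [mem_sphere_zero_iff_norm.1 hw]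
  exact hr.2

theorem log_one_add_norm_add_le (a b : ℂ) :
    Real.log (1 + ‖a + b‖) ≤ Real.log (1 + ‖a‖) + Real.log (1 + ‖b‖) := by
  rw [← Real.log_mul (by positivity) (by positivity)]
  refine Real.log_le_log (by positivity) ?_
  nlinarith [norm_add_le a b, norm_nonneg a, norm_nonneg b, mul_nonneg (norm_nonneg a) (norm_nonneg b)]

theorem log_one_add_norm_mul_le (a b : ℂ) :
    Real.log (1 + ‖a * b‖) ≤ Real.log (1 + ‖a‖) + Real.log (1 + ‖b‖) := by
  rw [← Real.log_mul (by positivity) (by positivity), norm_mul]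
  refine Real.log_le_log (by positivity) ?_
  nlinarith [norm_nonneg a, norm_nonneg b]

theorem log_one_add_nat_mul_le (n : ℕ) {x : ℝ} (hx : 0 ≤ x) :
    Real.log (1 + n * x) ≤ n * Real.log (1 + x) := by
  rw [← Real.log_pow]
  exact Real.log_le_log (by positivity) (one_add_mul_le_pow (by linarith) n)

/-- Common source of the sum and product estimates. Completeness needs it on a single circle, before
taking suprema. -/
theorem mean_add_le_of_pointwise {f g h : BallFun d} (hf : f.IsHolomorphic) (hg : g.IsHolomorphic)
    (hh : h.IsHolomorphic) {ζ : EuclideanSpace ℂ (Fin d)}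
    (hζ : ζ ∈ Metric.sphere (0 : EuclideanSpace ℂ (Fin d)) 1) {r : ℝ} (hr : r ∈ Set.Ioo (0 : ℝ) 1)
    (hle : ∀ z, Real.log (1 + ‖h.ext z‖) ≤
      Real.log (1 + ‖f.ext z‖) + Real.log (1 + ‖g.ext z‖)) :
    h.mean ζ r ≤ f.mean ζ r + g.mean ζ r := by
  have hif := hf.circleIntegrable hζ hr
  have hig := hg.circleIntegrable hζ hr
  rw [mean, mean, mean, ← Real.circleAverage_fun_add hif hig]
  exact Real.circleAverage_mono (hh.circleIntegrable hζ hr) (hif.add hig) fun w _ => hle _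

theorem size_le_add_of_pointwise {f g h : BallFun d} (hf : f.IsHolomorphic) (hg : g.IsHolomorphic)
    (hh : h.IsHolomorphic)
    (hle : ∀ z, Real.log (1 + ‖h.ext z‖) ≤
      Real.log (1 + ‖f.ext z‖) + Real.log (1 + ‖g.ext z‖)) :
    h.size ≤ f.size + g.size := by
  refine size_le fun ζ hζ r hr => ?_
  refine (ENNReal.ofReal_le_ofReal (mean_add_le_of_pointwise hf hg hh hζ hr hle)).trans ?_
  rw [ENNReal.ofReal_add (mean_nonneg _ _ _) (mean_nonneg _ _ _)]
  exact add_le_add (f.mean_le_size hζ hr) (g.mean_le_size hζ hr)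

theorem size_add_le {f g : BallFun d} (hf : f.IsHolomorphic) (hg : g.IsHolomorphic) :
    (f + g).size ≤ f.size + g.size :=
  size_le_add_of_pointwise hf hg (hf.add hg) fun z => by
    rw [ext_add]
    exact log_one_add_norm_add_le _ _

theorem size_mul_le {f g : BallFun d} (hf : f.IsHolomorphic) (hg : g.IsHolomorphic) :
    (f * g).size ≤ f.size + g.size :=
  size_le_add_of_pointwise hf hg (hf.mul hg) fun z => by
    rw [ext_mul]
    exact log_one_add_norm_mul_le _ _

theorem rho_comm (f g : BallFun d) : f.rho g = g.rho f := by
  simp only [rho, size, ext_sub, norm_sub_rev]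

theorem rho_self (f : BallFun d) : f.rho f = 0 := by
  refine le_antisymm (size_le fun ζ _ r _ => ?_) zero_le
  simp only [mean, ext_sub]
  simp only [sub_self, norm_zero, add_zero, Real.log_one,
    Real.circleAverage_const, ENNReal.ofReal_zero, le_refl]

theorem rho_triangle {f g h : BallFun d} (hf : f.IsHolomorphic) (hg : g.IsHolomorphic)
    (hh : h.IsHolomorphic) : f.rho h ≤ f.rho g + g.rho h := by
  have := size_add_le (hf.sub hg) (hg.sub hh)
  rwa [sub_add_sub_cancel] at this

theorem rho_lt_top {f g : BallFun d} (hf : f ∈ uniformNevanlinna d)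
    (hg : g ∈ uniformNevanlinna d) : f.rho g < ∞ := by
  refine (size_le_add_of_pointwise hf.1 hg.1 (hf.1.sub hg.1) fun z => ?_).trans_lt
    (ENNReal.add_lt_top.2 ⟨hf.2, hg.2⟩)
  have := log_one_add_norm_add_le (f.ext z) (-g.ext z)
  rwa [norm_neg, ← sub_eq_add_neg, ← ext_sub] at this

theorem size_mul_le_natCast_mul {f g : BallFun d} (hf : f.IsHolomorphic) (hg : g.IsHolomorphic)
    {n : ℕ} (hn : ∀ z ∈ UnitBall d, ‖f.ext z‖ ≤ n) : (f * g).size ≤ n * g.size := by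
  refine size_le fun ζ hζ r hr => ?_
  have hle : (f * g).mean ζ r ≤ n * g.mean ζ r := by
    rw [mean, mean, ← smul_eq_mul (n : ℝ), ← Real.circleAverage_fun_smul]
    refine Real.circleAverage_mono ((hf.mul hg).circleIntegrable hζ hr)
      ((hg.circleIntegrable hζ hr).const_fun_smul) fun w hw => ?_
    rw [abs_of_pos hr.1, mem_sphere_zero_iff_norm] at hw
    have hmem : w • ζ ∈ UnitBall d := smul_mem_unitBall_of_mem_sphere (hw ▸ hr.2) hζ
    refine le_trans ?_ (log_one_add_nat_mul_le n (norm_nonneg _))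
    rw [ext_mul, norm_mul]
    refine Real.log_le_log (by positivity) ?_
    have := mul_le_mul_of_nonneg_right (hn _ hmem) (norm_nonneg (g.ext (w • ζ)))
    linarith
  refine (ENNReal.ofReal_le_ofReal hle).trans ?_
  rw [ENNReal.ofReal_mul (Nat.cast_nonneg n), ENNReal.ofReal_natCast]
  gcongr
  exact g.mean_le_size hζ hr

/-- Uses `log (1 + x) ≤ x`. Only the ball of radius `r` enters, so locally uniform convergence
suffices to apply it. -/
theorem mean_le_of_norm_le {f : BallFun d} (hf : f.IsHolomorphic) {ζ : EuclideanSpace ℂ (Fin d)}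
    (hζ : ζ ∈ Metric.sphere (0 : EuclideanSpace ℂ (Fin d)) 1) {r : ℝ} (hr : r ∈ Set.Ioo (0 : ℝ) 1)
    {C : ℝ} (hC : ∀ z, ‖z‖ ≤ r → ‖f.ext z‖ ≤ C) : f.mean ζ r ≤ C := by
  refine Real.circleAverage_mono_on_of_le_circle (hf.circleIntegrable hζ hr) fun w hw => ?_
  rw [abs_of_pos hr.1, mem_sphere_zero_iff_norm] at hw
  rw [mem_sphere_zero_iff_norm] at hζ
  have h1 := hC (w • ζ) (by rw [norm_smul, hζ, hw, mul_one])
  have h2 := Real.log_le_sub_one_of_pos (show 0 < 1 + ‖f.ext (w • ζ)‖ by positivity)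
  linarith

theorem size_le_of_norm_le {f : BallFun d} (hf : f.IsHolomorphic) {C : ℝ}
    (hC : ∀ z ∈ UnitBall d, ‖f.ext z‖ ≤ C) : f.size ≤ ENNReal.ofReal C :=
  size_le fun _ hζ _ hr => ENNReal.ofReal_le_ofReal <| mean_le_of_norm_le hf hζ hr
    fun z hz => hC z (mem_ball_zero_iff.2 (hz.trans_lt hr.2))

theorem size_algebraMap_le (c : ℂ) : (algebraMap ℂ (BallFun d) c).size ≤ ENNReal.ofReal ‖c‖ :=
  size_le_of_norm_le (isHolomorphic_algebraMap c) fun z hz => by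
    rw [ext_of_mem _ hz]
    exact le_of_eq rfl

/-- The mean of `f_s` at radius `r` is the mean of `f` at radius `s * r`. -/
theorem size_dilate_le (f : BallFun d) {s : ℝ} (hs : s ∈ Set.Ioo (0 : ℝ) 1) :
    (f.dilate s).size ≤ f.size := by
  refine size_le fun ζ hζ r hr => ?_
  have hmean : (f.dilate s).mean ζ r = f.mean ζ (s * r) := by
    rw [mean, mean, Real.circleAverage_def, Real.circleAverage_def]
    congr 2
    ext θ
    have hmem : circleMap 0 r θ • ζ ∈ UnitBall d :=
      smul_mem_unitBall_of_mem_sphere (by simpa [abs_of_pos hr.1] using hr.2) hζ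
    rw [ext_dilate _ _ hmem, smul_smul]
    simp [circleMap, mul_assoc]
  rw [hmean]
  exact f.mean_le_size hζ ⟨mul_pos hs.1 hr.1, by nlinarith [hs.1, hs.2, hr.1, hr.2]⟩

theorem exists_nat_norm_dilate_le {f : BallFun d} (hf : f.IsHolomorphic) {r : ℝ}
    (hr : r ∈ Set.Ioo (0 : ℝ) 1) : ∃ n : ℕ, ∀ z ∈ UnitBall d, ‖(f.dilate r).ext z‖ ≤ n := by
  obtain ⟨C, hC⟩ := (isCompact_closedBall (0 : EuclideanSpace ℂ (Fin d)) r).exists_bound_of_continuousOn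
    ((DifferentiableOn.continuousOn hf).mono (Metric.closedBall_subset_ball hr.2))
  obtain ⟨n, hn⟩ := exists_nat_ge C
  refine ⟨n, fun z hz => ?_⟩
  rw [ext_dilate _ _ hz]
  refine (hC _ ?_).trans hn
  rw [mem_ball_zero_iff] at hz
  rw [mem_closedBall_zero_iff, norm_smul, Complex.norm_real, Real.norm_of_nonneg hr.1.le]
  exact mul_le_of_le_one_right hr.1.le hz.le

theorem exists_norm_eq_one_smul_eq (hd : 0 < d) (z : EuclideanSpace ℂ (Fin d)) :
    ∃ ζ ∈ Metric.sphere (0 : EuclideanSpace ℂ (Fin d)) 1, z = (‖z‖ : ℂ) • ζ := by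
  rcases eq_or_ne z 0 with rfl | hz
  · exact ⟨EuclideanSpace.single ⟨0, hd⟩ 1, by simp, by simp⟩
  · have h : ‖z‖ ≠ 0 := norm_ne_zero_iff.2 hz
    refine ⟨(‖z‖ : ℂ)⁻¹ • z, ?_, ?_⟩
    · simp [norm_smul, h]
    · rw [smul_smul, mul_inv_cancel₀ (by exact_mod_cast h), one_smul]

/-- Functions of finite size are controlled pointwise by their size. -/
theorem log_one_add_norm_ext_le (hd : 0 < d) {f : BallFun d} (hf : f ∈ uniformNevanlinna d)
    {z : EuclideanSpace ℂ (Fin d)} (hz : z ∈ UnitBall d) :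
    Real.log (1 + ‖f.ext z‖) ≤ 4 * f.size.toReal / (1 - ‖z‖) ^ 2 := by
  obtain ⟨ζ, hζ, hzζ⟩ := exists_norm_eq_one_smul_eq hd z
  have hz1 : ‖z‖ < 1 := by simpa using hz
  have hslice : DifferentiableOn ℂ (fun w : ℂ => f.ext (w • ζ)) (Metric.ball 0 1) :=
    DifferentiableOn.comp (g := f.ext) (f := fun w : ℂ => w • ζ) hf.1 (by fun_prop) fun w hw =>
      smul_mem_unitBall_of_mem_sphere (by simpa using hw) hζ
  have := log_one_add_norm_le_of_circleAverage_le hslice (B := f.size.toReal)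
    (fun r hr => (ENNReal.ofReal_le_iff_le_toReal hf.2.ne).1 (f.mean_le_size hζ hr))
    (a := (‖z‖ : ℂ)) (by simpa using hz1)
  rw [← hzζ] at this
  simpa using this

/-- The bound tends to `0` with `η`, so convergence in `ρ` forces locally uniform convergence. -/
theorem norm_ext_le_exp_sub_one (hd : 0 < d) {f : BallFun d} (hf : f.IsHolomorphic) {η : ℝ}
    (hη : 0 ≤ η) (hsize : f.size ≤ ENNReal.ofReal η) {s : ℝ} (hs : s < 1)
    {z : EuclideanSpace ℂ (Fin d)} (hz : ‖z‖ ≤ s) :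
    ‖f.ext z‖ ≤ Real.exp (4 * η / (1 - s) ^ 2) - 1 := by
  have h1 := log_one_add_norm_ext_le hd ⟨hf, hsize.trans_lt ENNReal.ofReal_lt_top⟩
    (mem_ball_zero_iff.2 (hz.trans_lt hs))
  have h2 : f.size.toReal ≤ η := ENNReal.toReal_le_of_le_ofReal hη hsize
  have h3 : Real.log (1 + ‖f.ext z‖) ≤ 4 * η / (1 - s) ^ 2 := by
    refine h1.trans ?_
    have : 0 < 1 - s := by linarith
    gcongr
  rw [Real.log_le_iff_le_exp (by positivity)] at h3
  linarith

theorem eq_of_rho_eq_zero (hd : 0 < d) {f g : BallFun d} (hf : f.IsHolomorphic)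
    (hg : g.IsHolomorphic) (h : f.rho g = 0) : f = g := by
  refine funext fun z => ?_
  have hz : ‖(z : EuclideanSpace ℂ (Fin d))‖ < 1 := mem_ball_zero_iff.1 z.2
  have := norm_ext_le_exp_sub_one hd (hf.sub hg) le_rfl (by simpa [rho] using h.le) hz le_rfl
  rw [← ext_coe f, ← ext_coe g]
  simpa [sub_eq_zero] using this

end BallFun

/-! ### Continuity of the operations with respect to the size -/

namespace BallFun

variable {d : ℕ}

theorem eventually_mem_Ioo : ∀ᶠ r : ℝ in 𝓝[<] 1, r ∈ Set.Ioo (0 : ℝ) 1 :=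
  Ioo_mem_nhdsLT one_pos

theorem exists_rho_dilate_le {f : BallFun d} (hf : f ∈ uniformSmirnov d) {ε : ℝ≥0∞} (hε : 0 < ε) :
    ∃ r ∈ Set.Ioo (0 : ℝ) 1, (f.dilate r).rho f ≤ ε := by
  obtain ⟨r, h1, h2⟩ :=
    ((ENNReal.tendsto_nhds_zero.1 hf.2 ε hε).and eventually_mem_Ioo).exists
  exact ⟨r, h2, h1⟩

/-- Multiplication by a fixed element of `N_u^+` is continuous at the origin. -/
theorem tendsto_size_mul {f : BallFun d} (hf : f ∈ uniformSmirnov d) {ι : Type*} {l : Filter ι}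
    {h : ι → BallFun d} (hh : ∀ᶠ i in l, (h i).IsHolomorphic)
    (hlim : Tendsto (fun i => (h i).size) l (𝓝 0)) :
    Tendsto (fun i => (f * h i).size) l (𝓝 0) := by
  rw [ENNReal.tendsto_nhds_zero]
  intro ε hε
  rcases eq_or_ne ε ∞ with rfl | hεtop
  · exact Eventually.of_forall fun _ => le_top
  -- Fixing `r` first makes the bound `n` for `f_r` independent of `i`.
  obtain ⟨r, hr, hrho⟩ := exists_rho_dilate_le hf (ENNReal.half_pos hε.ne')
  have hfr := hf.1.1.dilate hr
  obtain ⟨n, hn⟩ := exists_nat_norm_dilate_le hf.1.1 hr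
  have hbig : Tendsto (fun i => ε / 2 + (h i).size + n * (h i).size) l (𝓝 (ε / 2 + 0 + n * 0)) :=
    (tendsto_const_nhds.add hlim).add
      (ENNReal.Tendsto.const_mul hlim (Or.inr (ENNReal.natCast_ne_top n)))
  rw [mul_zero, add_zero, add_zero] at hbig
  filter_upwards [hh, hbig.eventually_lt_const (ENNReal.half_lt_self hε.ne' hεtop)] with i hi hlt
  refine le_trans ?_ hlt.le
  have hsplit : f * h i = (f - f.dilate r) * h i + f.dilate r * h i := by ring
  rw [hsplit]
  refine (size_add_le ((hf.1.1.sub hfr).mul hi) (hfr.mul hi)).trans ?_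
  refine add_le_add ((size_mul_le (hf.1.1.sub hfr) hi).trans ?_) (size_mul_le_natCast_mul hfr hi hn)
  gcongr
  exact (rho_comm f (f.dilate r)).trans_le hrho

/-- The standard decomposition of a difference of products, in the limit. -/
theorem tendsto_rho_mul {f g : BallFun d} (hf : f ∈ uniformSmirnov d) (hg : g ∈ uniformSmirnov d)
    {ι : Type*} {l : Filter ι} {u v : ι → BallFun d} (hu : ∀ᶠ i in l, (u i).IsHolomorphic)
    (hv : ∀ᶠ i in l, (v i).IsHolomorphic) (huf : Tendsto (fun i => (u i).rho f) l (𝓝 0))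
    (hvg : Tendsto (fun i => (v i).rho g) l (𝓝 0)) :
    Tendsto (fun i => (u i * v i).rho (f * g)) l (𝓝 0) := by
  have h1 := tendsto_size_mul hf (hv.mono fun i hi => hi.sub hg.1.1) hvg
  have h2 := tendsto_size_mul hg (hu.mono fun i hi => hi.sub hf.1.1) huf
  have h3 := (huf.add hvg).add (h1.add h2)
  simp only [add_zero] at h3
  refine tendsto_of_tendsto_of_tendsto_of_le_of_le' tendsto_const_nhds h3
    (Eventually.of_forall fun _ => zero_le) ?_
  filter_upwards [hu, hv] with i hui hvi
  -- Only the fixed factors `f` and `g` need to lie in `N_u^+`; holomorphy of `u i` and `v i`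
  -- suffices, so dilations are allowed.
  have hsplit : u i * v i - f * g =
      (u i - f) * (v i - g) + (f * (v i - g) + g * (u i - f)) := by ring
  have huf' := hui.sub hf.1.1
  have hvg' := hvi.sub hg.1.1
  rw [rho, hsplit]
  refine (size_add_le (huf'.mul hvg') ((hf.1.1.mul hvg').add (hg.1.1.mul huf'))).trans ?_
  exact add_le_add (size_mul_le huf' hvg') (size_add_le (hf.1.1.mul hvg') (hg.1.1.mul huf'))

theorem tendsto_rho_add {f g : BallFun d} (hf : f.IsHolomorphic) (hg : g.IsHolomorphic)
    {ι : Type*} {l : Filter ι} {u v : ι → BallFun d} (hu : ∀ᶠ i in l, (u i).IsHolomorphic)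
    (hv : ∀ᶠ i in l, (v i).IsHolomorphic) (huf : Tendsto (fun i => (u i).rho f) l (𝓝 0))
    (hvg : Tendsto (fun i => (v i).rho g) l (𝓝 0)) :
    Tendsto (fun i => (u i + v i).rho (f + g)) l (𝓝 0) := by
  have h3 := huf.add hvg
  rw [add_zero] at h3
  refine tendsto_of_tendsto_of_tendsto_of_le_of_le' tendsto_const_nhds h3
    (Eventually.of_forall fun _ => zero_le) ?_
  filter_upwards [hu, hv] with i hui hvi
  have := size_add_le (hui.sub hf) (hvi.sub hg)
  rwa [sub_add_sub_comm] at this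

end BallFun

/-! ### The algebra and its metric -/

open BallFun

theorem algebraMap_mem_uniformSmirnov {d : ℕ} (c : ℂ) :
    algebraMap ℂ (BallFun d) c ∈ uniformSmirnov d := by
  refine ⟨⟨isHolomorphic_algebraMap c, (size_algebraMap_le c).trans_lt ENNReal.ofReal_lt_top⟩, ?_⟩
  refine tendsto_const_nhds.congr' ?_
  filter_upwards [eventually_mem_Ioo] with r hr
  rw [dilate_algebraMap c hr, rho_self]

/-- The uniform Smirnov class as an algebra. -/
noncomputable def smirnovAlgebra (d : ℕ) : Subalgebra ℂ (BallFun d) where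
  carrier := uniformSmirnov d
  mul_mem' := by
    intro f g hf hg
    refine ⟨⟨hf.1.1.mul hg.1.1, (size_mul_le hf.1.1 hg.1.1).trans_lt
      (ENNReal.add_lt_top.2 ⟨hf.1.2, hg.1.2⟩)⟩, ?_⟩
    -- Since `(f g)_r = f_r g_r`, closure under products is continuity of the product along `r ↑ 1`.
    simp only [dilate_mul]
    exact tendsto_rho_mul hf hg (eventually_mem_Ioo.mono fun r hr => hf.1.1.dilate hr)
      (eventually_mem_Ioo.mono fun r hr => hg.1.1.dilate hr) hf.2 hg.2
  add_mem' := by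
    intro f g hf hg
    refine ⟨⟨hf.1.1.add hg.1.1, (size_add_le hf.1.1 hg.1.1).trans_lt
      (ENNReal.add_lt_top.2 ⟨hf.1.2, hg.1.2⟩)⟩, ?_⟩
    simp only [dilate_add]
    exact tendsto_rho_add hf.1.1 hg.1.1 (eventually_mem_Ioo.mono fun r hr => hf.1.1.dilate hr)
      (eventually_mem_Ioo.mono fun r hr => hg.1.1.dilate hr) hf.2 hg.2
  algebraMap_mem' := algebraMap_mem_uniformSmirnov

theorem coe_smirnovAlgebra (d : ℕ) : (smirnovAlgebra d : Set (BallFun d)) = uniformSmirnov d := rfl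

/-- The metric `ρ` on the uniform Smirnov class. -/
noncomputable abbrev smirnovMetricSpace {d : ℕ} (hd : 0 < d) : MetricSpace (smirnovAlgebra d) :=
  let _ : EMetricSpace (smirnovAlgebra d) :=
    { edist := fun f g => rho (f : BallFun d) (g : BallFun d)
      edist_self := fun f => rho_self _
      edist_comm := fun f g => rho_comm _ _
      edist_triangle := fun f g h => rho_triangle f.2.1.1 g.2.1.1 h.2.1.1
      eq_of_edist_eq_zero := fun {f g} h =>
        Subtype.ext (eq_of_rho_eq_zero hd f.2.1.1 g.2.1.1 h) }
  EMetricSpace.toMetricSpace fun f g => (rho_lt_top f.2.1 g.2.1).ne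

/-! ### F-space structure and completeness -/

section Metric

variable {d : ℕ} [MetricSpace (smirnovAlgebra d)]
  (hedist : ∀ f g : smirnovAlgebra d, edist f g = rho (f : BallFun d) (g : BallFun d))

include hedist

theorem smirnovAlgebra_continuous_mul :
    Continuous fun p : smirnovAlgebra d × smirnovAlgebra d => p.1 * p.2 := by
  refine continuous_iff_continuousAt.2 fun p => ?_
  have h1 := tendsto_iff_edist_tendsto_0.1 (continuousAt_fst (p := p))
  have h2 := tendsto_iff_edist_tendsto_0.1 (continuousAt_snd (p := p))
  refine tendsto_iff_edist_tendsto_0.2 ?_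
  simp only [hedist] at h1 h2 ⊢
  exact tendsto_rho_mul p.1.2 p.2.2 (Eventually.of_forall fun q => q.1.2.1.1)
    (Eventually.of_forall fun q => q.2.2.1.1) h1 h2

theorem smirnovAlgebra_continuous_add :
    Continuous fun p : smirnovAlgebra d × smirnovAlgebra d => p.1 + p.2 := by
  refine continuous_iff_continuousAt.2 fun p => ?_
  have h1 := tendsto_iff_edist_tendsto_0.1 (continuousAt_fst (p := p))
  have h2 := tendsto_iff_edist_tendsto_0.1 (continuousAt_snd (p := p))
  refine tendsto_iff_edist_tendsto_0.2 ?_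
  simp only [hedist] at h1 h2 ⊢
  exact tendsto_rho_add p.1.2.1.1 p.2.2.1.1 (Eventually.of_forall fun q => q.1.2.1.1)
    (Eventually.of_forall fun q => q.2.2.1.1) h1 h2

theorem smirnovAlgebra_continuous_algebraMap :
    Continuous (algebraMap ℂ (smirnovAlgebra d)) := by
  refine LipschitzWith.continuous (K := 1) fun a b => ?_
  rw [hedist, ENNReal.coe_one, one_mul, edist_dist, dist_eq_norm]
  have := size_algebraMap_le (d := d) (a - b)
  rwa [map_sub] at this

/-- Scalars act as constant functions, whose embedding is 1-Lipschitz. -/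
theorem smirnovAlgebra_continuous_smul :
    Continuous fun p : ℂ × smirnovAlgebra d => p.1 • p.2 := by
  simp only [Algebra.smul_def]
  exact (smirnovAlgebra_continuous_mul hedist).comp
    (((smirnovAlgebra_continuous_algebraMap hedist).comp continuous_fst).prodMk continuous_snd)

theorem smirnovAlgebra_dist_add_right (f g h : smirnovAlgebra d) :
    dist (f + h) (g + h) = dist f g := by
  have : edist (f + h) (g + h) = edist f g := by
    rw [hedist, hedist]
    exact congrArg size (add_sub_add_right_eq_sub (f : BallFun d) g h)
  rw [dist_edist, dist_edist, this]

theorem smirnovAlgebra_completeSpace (hd : 0 < d) : CompleteSpace (smirnovAlgebra d) := by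
  refine EMetric.complete_of_cauchySeq_tendsto fun u hu => ?_
  have hhol : ∀ n, (u n : BallFun d).IsHolomorphic := fun n => (u n).2.1.1
  have hcauchy : ∀ ε : ℝ, 0 < ε → ∃ N, ∀ m ≥ N, ∀ n ≥ N,
      rho (u m : BallFun d) (u n) ≤ ENNReal.ofReal ε := by
    intro ε hε
    obtain ⟨N, hN⟩ := EMetric.cauchySeq_iff.1 hu (ENNReal.ofReal ε) (ENNReal.ofReal_pos.2 hε)
    exact ⟨N, fun m hm n hn => (hedist _ _).symm.trans_le (hN m hm n hn).le⟩
  let F : ℕ → EuclideanSpace ℂ (Fin d) → ℂ := fun n => (u n : BallFun d).ext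
  have hunif : ∀ s < 1, UniformCauchySeqOn F atTop (Metric.closedBall 0 s) := by
    intro s hs
    rw [Metric.uniformCauchySeqOn_iff]
    intro ε hε
    obtain ⟨η, hη, hηε⟩ : ∃ η > 0, Real.exp (4 * η / (1 - s) ^ 2) - 1 < ε := by
      have hcont : ContinuousAt (fun η : ℝ => Real.exp (4 * η / (1 - s) ^ 2) - 1) 0 := by fun_prop
      have hlt : ∀ᶠ η : ℝ in 𝓝 0, Real.exp (4 * η / (1 - s) ^ 2) - 1 < ε :=
        hcont.eventually_lt_const (by simpa using hε)
      obtain ⟨η, h1, h2⟩ := ((hlt.filter_mono nhdsWithin_le_nhds).and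
        (self_mem_nhdsWithin (s := Set.Ioi (0 : ℝ)))).exists
      exact ⟨η, h2, h1⟩
    obtain ⟨N, hN⟩ := hcauchy η hη
    refine ⟨N, fun m hm n hn z hz => ?_⟩
    have := norm_ext_le_exp_sub_one hd ((hhol m).sub (hhol n)) hη.le (hN m hm n hn) hs
      (mem_closedBall_zero_iff.1 hz)
    rw [ext_sub] at this
    rw [dist_eq_norm]
    exact this.trans_lt hηε
  have hpt : ∀ z : UnitBall d, ∃ a, Tendsto (fun n => F n z) atTop (𝓝 a) := fun z =>
    cauchySeq_tendsto_of_complete ((hunif _ (mem_ball_zero_iff.1 z.2)).cauchySeq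
      (mem_closedBall_zero_iff.2 le_rfl))
  choose g hg using hpt
  let G : BallFun d := g
  have hlim : ∀ s < 1, TendstoUniformlyOn F G.ext atTop (Metric.closedBall 0 s) := by
    intro s hs
    refine (hunif s hs).tendstoUniformlyOn_of_tendsto fun z hz => ?_
    have hz' : z ∈ UnitBall d := Metric.closedBall_subset_ball hs hz
    rw [ext_of_mem G hz']
    exact hg ⟨z, hz'⟩
  have hG : G.IsHolomorphic := by
    refine differentiableOn_of_tendstoUniformlyOn_nhds Metric.isOpen_ball hhol fun z hz => ?_
    obtain ⟨s, hzs, hs⟩ := exists_between (mem_ball_zero_iff.1 hz)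
    refine ⟨Metric.closedBall 0 s, ?_, hlim s hs⟩
    exact mem_of_superset (Metric.isOpen_ball.mem_nhds (mem_ball_zero_iff.2 hzs))
      Metric.ball_subset_closedBall
  -- On each circle, comparison with a later `u m` that is uniformly `η`-close to `G` there gives a
  -- mean at most `ε + η`. The index `m` may depend on the circle; `N` does not.
  have hrho : ∀ ε : ℝ, 0 < ε → ∃ N, ∀ n ≥ N, rho (u n : BallFun d) G ≤ ENNReal.ofReal ε := by
    intro ε hε
    obtain ⟨N, hN⟩ := hcauchy ε hε
    refine ⟨N, fun n hn => size_le fun ζ hζ r hr => ENNReal.ofReal_le_ofReal ?_⟩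
    refine le_of_forall_pos_le_add fun η hη => ?_
    obtain ⟨m, hm, hmN⟩ := ((Metric.tendstoUniformlyOn_iff.1 (hlim r hr.2) η hη).and
      (eventually_ge_atTop N)).exists
    have h1 : (u m - G : BallFun d).mean ζ r ≤ η :=
      mean_le_of_norm_le ((hhol m).sub hG) hζ hr fun z hz => by
        have := hm z (mem_closedBall_zero_iff.2 hz)
        rw [dist_comm, dist_eq_norm] at this
        rw [ext_sub]
        exact this.le
    have h2 : (u n - u m : BallFun d).mean ζ r ≤ ε :=
      (ENNReal.ofReal_le_ofReal_iff hε.le).1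
        ((mean_le_size _ hζ hr).trans (hN n hn m hmN))
    refine (mean_add_le_of_pointwise ((hhol n).sub (hhol m)) ((hhol m).sub hG)
      ((hhol n).sub hG) hζ hr fun z => ?_).trans (add_le_add h2 h1)
    have := log_one_add_norm_add_le ((u n - u m : BallFun d).ext z) ((u m - G : BallFun d).ext z)
    rwa [← ext_add, sub_add_sub_cancel] at this
  have hmemN : G ∈ uniformNevanlinna d := by
    obtain ⟨N, hN⟩ := hrho 1 one_pos
    have h1 := size_add_le ((hG.sub (hhol N))) (hhol N)
    rw [sub_add_cancel] at h1
    refine ⟨hG, h1.trans_lt (ENNReal.add_lt_top.2 ⟨?_, (u N).2.1.2⟩)⟩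
    exact (rho_comm G (u N)).trans_lt ((hN N le_rfl).trans_lt ENNReal.ofReal_lt_top)
  -- An `ε / 3` argument through `u N`: dilation does not increase the size, so `G_r` is as close to
  -- the dilate of `u N` as `G` is to `u N`.
  have hmem : G ∈ uniformSmirnov d := by
    refine ⟨hmemN, ENNReal.tendsto_nhds_zero.2 fun ε hε => ?_⟩
    obtain ⟨η, hη, hηε⟩ : ∃ η : ℝ, 0 < η ∧ ENNReal.ofReal η ≤ ε / 3 := by
      obtain ⟨x, hx0, hx⟩ := ENNReal.lt_iff_exists_real_btwn.1
        (ENNReal.div_pos hε.ne' (by simp : (3 : ℝ≥0∞) ≠ ∞))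
      exact ⟨x, ENNReal.ofReal_pos.1 hx.1, hx.2.le⟩
    obtain ⟨N, hN⟩ := hrho η hη
    have hNε := (hN N le_rfl).trans hηε
    filter_upwards [eventually_mem_Ioo, ENNReal.tendsto_nhds_zero.1 (u N).2.2 (ε / 3)
      (ENNReal.div_pos hε.ne' (by simp))] with r hr hr'
    have h1 := rho_triangle (hG.dilate hr) ((hhol N).dilate hr) hG
    have h2 := rho_triangle ((hhol N).dilate hr) (hhol N) hG
    have h3 : (G.dilate r).rho ((u N : BallFun d).dilate r) ≤ ε / 3 := by
      rw [rho, ← dilate_sub]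
      exact (size_dilate_le _ hr).trans ((rho_comm G (u N)).trans_le hNε)
    calc (G.dilate r).rho G ≤ ε / 3 + (ε / 3 + ε / 3) :=
          h1.trans (add_le_add h3 (h2.trans (add_le_add hr' hNε)))
      _ = ε := by rw [← add_assoc, ENNReal.add_thirds]
  refine ⟨⟨G, hmem⟩, tendsto_iff_edist_tendsto_0.2 (ENNReal.tendsto_nhds_zero.2 fun ε hε => ?_)⟩
  obtain ⟨x, hx0, hx⟩ := ENNReal.lt_iff_exists_real_btwn.1 hε
  obtain ⟨N, hN⟩ := hrho x (ENNReal.ofReal_pos.1 hx.1)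
  filter_upwards [eventually_ge_atTop N] with n hn
  rw [hedist]
  exact (hN n hn).trans hx.2.le

end Metric

/-! ### Membership and density of the polynomials -/

namespace BallFun

variable {d : ℕ}

theorem isHolomorphic_ofPoly (p : MvPolynomial (Fin d) ℂ) : (ofPoly p).IsHolomorphic := by
  refine .of_eq (F := fun z => MvPolynomial.eval (fun i => z i) p) ?_ fun _ => rfl
  refine Differentiable.differentiableOn ?_
  induction p using MvPolynomial.induction_on with
  | C a => simp
  | add p q hp hq =>
    simp only [map_add]
    exact hp.add hq
  | mul_X p i hp =>
    simp only [map_mul, MvPolynomial.eval_X]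
    exact hp.mul (by fun_prop)

/-- Here `|r z_i - z_i| ≤ 1 - r` on the ball. Coordinates and constants generate all polynomials, so
the subalgebra property does the rest. -/
theorem ofPoly_X_mem (i : Fin d) : ofPoly (MvPolynomial.X i) ∈ smirnovAlgebra d := by
  have happly : ∀ z ∈ UnitBall d, (ofPoly (MvPolynomial.X i)).ext z = z i := fun z hz => by
    rw [ext_of_mem _ hz]
    simp [ofPoly]
  have hcoord : ∀ z ∈ UnitBall d, ‖z i‖ ≤ 1 := fun z hz =>
    (PiLp.norm_apply_le z i).trans (mem_ball_zero_iff.1 hz).le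
  have hhol := isHolomorphic_ofPoly (MvPolynomial.X i : MvPolynomial (Fin d) ℂ)
  refine ⟨⟨hhol, (size_le_of_norm_le hhol (C := 1) fun z hz => ?_).trans_lt
    ENNReal.ofReal_lt_top⟩, ?_⟩
  · rw [happly z hz]
    exact hcoord z hz
  · have hlim : Tendsto (fun r : ℝ => ENNReal.ofReal (1 - r)) (𝓝[<] 1) (𝓝 0) := by
      have : Continuous fun r : ℝ => ENNReal.ofReal (1 - r) :=
        ENNReal.continuous_ofReal.comp (by fun_prop)
      simpa using (this.tendsto 1).mono_left nhdsWithin_le_nhds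
    refine tendsto_of_tendsto_of_tendsto_of_le_of_le' tendsto_const_nhds hlim
      (Eventually.of_forall fun _ => zero_le) ?_
    filter_upwards [eventually_mem_Ioo] with r hr
    refine size_le_of_norm_le ((hhol.dilate hr).sub hhol) fun z hz => ?_
    rw [ext_sub, ext_dilate _ _ hz, happly z hz,
      happly _ (smul_mem_unitBall (norm_ofReal_lt_one hr).le hz)]
    have : ((r : ℂ) • z) i - z i = -((1 - r : ℝ) : ℂ) * z i := by
      simp
      ring
    rw [this, norm_mul, norm_neg, Complex.norm_real, Real.norm_of_nonneg (by linarith [hr.2])]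
    exact mul_le_of_le_one_right (by linarith [hr.2]) (hcoord z hz)

theorem ofPoly_mem (p : MvPolynomial (Fin d) ℂ) : ofPoly p ∈ smirnovAlgebra d := by
  induction p using MvPolynomial.induction_on with
  | C a =>
    have : ofPoly (MvPolynomial.C a) = algebraMap ℂ (BallFun d) a :=
      funext fun z => MvPolynomial.eval_C a
    rw [this]
    exact (smirnovAlgebra d).algebraMap_mem a
  | add p q hp hq =>
    have : ofPoly (p + q) = ofPoly p + ofPoly q := funext fun z => map_add _ p q
    rw [this]
    exact add_mem hp hq
  | mul_X p i hp =>
    have : ofPoly (p * MvPolynomial.X i) = ofPoly p * ofPoly (MvPolynomial.X i) :=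
      funext fun z => map_mul _ p _
    rw [this]
    exact mul_mem hp (ofPoly_X_mem i)

theorem exists_rho_ofPoly_lt {f : BallFun d} (hf : f ∈ uniformSmirnov d) {ε : ℝ≥0∞}
    (hε : 0 < ε) : ∃ p : MvPolynomial (Fin d) ℂ, f.rho (ofPoly p) < ε := by
  obtain ⟨η, hη0, hη⟩ := ENNReal.lt_iff_exists_real_btwn.1 hε
  have hη' : 0 < η := ENNReal.ofReal_pos.1 hη.1
  obtain ⟨r, hr, hrho⟩ := exists_rho_dilate_le hf (ENNReal.ofReal_pos.2 (half_pos hη'))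
  obtain ⟨p, hp⟩ := exists_mvPolynomial_norm_sub_le hf.1.1 hr (half_pos hη')
  refine ⟨p, ?_⟩
  have hfr := hf.1.1.dilate hr
  have hpoly := isHolomorphic_ofPoly p
  have h1 : (f.dilate r).rho (ofPoly p) ≤ ENNReal.ofReal (η / 2) := by
    refine size_le_of_norm_le (hfr.sub hpoly) fun z hz => ?_
    rw [ext_sub, ext_dilate _ _ hz, ext_of_mem (ofPoly p) hz]
    exact hp z hz
  refine lt_of_le_of_lt ?_ hη.2
  calc f.rho (ofPoly p) ≤ f.rho (f.dilate r) + (f.dilate r).rho (ofPoly p) :=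
        rho_triangle hf.1.1 hfr hpoly
    _ ≤ ENNReal.ofReal (η / 2) + ENNReal.ofReal (η / 2) :=
        add_le_add ((rho_comm _ _).trans_le hrho) h1
    _ = ENNReal.ofReal η := by
        rw [← ENNReal.ofReal_add (half_pos hη').le (half_pos hη').le, add_halves]

end BallFun

/-- `N_u^+` is an algebra under pointwise operations, `ρ` is a (finite) metric on it which makes it
an F-space, multiplication is (jointly) continuous, and the polynomials belong to `N_u^+` and are
dense in it. Both witnesses are determined uniquely, by the first two conjuncts. -/
theorem proposition2p2 (d : ℕ) (hd : 0 < d) :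
    ∃ (A : Subalgebra ℂ (BallFun d)) (_ : MetricSpace A),
      (A : Set (BallFun d)) = uniformSmirnov d ∧
      (∀ f g : A, edist f g = BallFun.rho (f : BallFun d) (g : BallFun d)) ∧
      IsFSpace A ∧
      (Continuous fun p : A × A => p.1 * p.2) ∧
      (∀ p : MvPolynomial (Fin d) ℂ, BallFun.ofPoly p ∈ A) ∧
      Dense {f : A | ∃ p : MvPolynomial (Fin d) ℂ, (f : BallFun d) = BallFun.ofPoly p} := by
  let _ : MetricSpace (smirnovAlgebra d) := smirnovMetricSpace hd
  have hedist : ∀ f g : smirnovAlgebra d,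
      edist f g = BallFun.rho (f : BallFun d) (g : BallFun d) := fun _ _ => rfl
  refine ⟨smirnovAlgebra d, inferInstance, coe_smirnovAlgebra d, hedist,
    ⟨smirnovAlgebra_continuous_add hedist, smirnovAlgebra_continuous_smul hedist,
      smirnovAlgebra_dist_add_right hedist, smirnovAlgebra_completeSpace hedist hd⟩,
    smirnovAlgebra_continuous_mul hedist, ofPoly_mem, fun f => ?_⟩
  refine EMetric.mem_closure_iff.2 fun ε hε => ?_
  obtain ⟨p, hp⟩ := exists_rho_ofPoly_lt f.2 hε
  exact ⟨⟨ofPoly p, ofPoly_mem p⟩, ⟨p, rfl⟩, hp⟩
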